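/- Let $\mathcal{T}$ be a compactly generated triangulated category: $\mathcal T$ has small coproducts, and there is a set of compact objects such that any $t\in\mathcal T$ receiving no nonzero morphism from any shift of an object of this set is zero. Here $c$ is compact if $\operatorname{Hom}_{\mathcal T}(c,-)$ commutes with small coproducts; write $\mathcal T^{\mathsf c}$ for the subcategory of compact objects. Let $M$ be a compact silting object of $\mathcal{T}$, i.e. $\operatorname{Hom}_{\mathcal T}(M,M[i])=0$ for all $i>0$, and the smallest thick subcategory containing $M$ is $\mathcal{T}^{\mathsf c}$. Let $$\mathcal{T}^{\mathsf b}=\{t\in\mathcal{T} : \text{for every } c\in\mathcal{T}^{\mathsf c},\ \operatorname{Hom}_{\mathcal T}(c,t[n])=0 \text{ for } |n|\gg 0\},$$ $$M^{\perp_{>0}}=\{t : \operatorname{Hom}_{\mathcal T}(M,t[i])=0\ \forall i>0\},\qquad \mathcal{H}_M=\{t : \operatorname{Hom}_{\mathcal T}(M,t[i])=0\ \forall i\neq 0\}.$$ For $x\in\mathcal{T}$ let $\operatorname{pd}_{\mathcal{H}_M}x$ be the least integer $n$ such that $\operatorname{Hom}_{\mathcal T}(x,y[k])=0$ for all $y\in\mathcal{H}_M$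 and all $k>n$, with value $\infty$ if there is no such integer and $-\infty$ if every integer has this property. Let $\operatorname{Add}M[i]$ be the subcategory of direct summands of small coproducts of copies of $M[i]$, and for subcategories $\mathcal{X},\mathcal{Y}$ let $\mathcal{X}\ast\mathcal{Y}$ consist of the objects $t$ lying in a distinguished triangle $a\to t\to b\to a[1]$ with $a\in\mathcal{X}$, $b\in\mathcal{Y}$. Then for every $x\in\mathcal{T}^{\mathsf b}\cap M^{\perp_{>0}}$ and every integer $d\geq 0$ the following are equivalent: (i) $x\in \operatorname{Add}M\ast\operatorname{Add}M[1]\ast\cdots\ast\operatorname{Add}M[d]$; (ii) $\operatorname{pd}_{\mathcal{H}_M}x\leq d$. -/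

import Mathlib

open CategoryTheory CategoryTheory.Limits CategoryTheory.Pretriangulated

universe v u

noncomputable section

namespace SiltingPd

section Orthogonals

variable {T : Type u} [Category.{v} T] [Preadditive T] [HasShift T ℤ]

/-- `perp M I` is the subcategory `M^{⊥_I}` of the objects `y` such that
`Hom(M, y[i]) = 0` for all `i ∈ I`. -/
def perp (M : T) (I : Set ℤ) : ObjectProperty T :=
  fun y => ∀ i ∈ I, ∀ f : M ⟶ y⟦i⟧, f = 0

/-- The heart `M^{⊥_{≠ 0}}` attached to an object `M`. When `M` is a compact silting object it is
the heart of the t-structure `(M^{⊥_{> 0}}, M^{⊥_{≤ 0}})`. -/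
def heart (M : T) : ObjectProperty T := perp M {i | i ≠ 0}

/-- The objects `t` such that, for every `x` in `P`, `Hom(x, t[n]) = 0` for `|n| ≫ 0`. -/
def rightFarOrthogonal (P : ObjectProperty T) : ObjectProperty T :=
  fun t => ∀ x : T, P x → ∃ N : ℕ, ∀ n : ℤ, (N : ℤ) ≤ |n| → ∀ f : x ⟶ t⟦n⟧, f = 0

/-- `Hom(x, y[k]) = 0` for all `y` in `H` and all integers `k > n`. -/
def HomVanishesAbove (H : ObjectProperty T) (x : T) (n : ℤ) : Prop :=
  ∀ y : T, H y → ∀ k : ℤ, n < k → ∀ f : x ⟶ y⟦k⟧, f = 0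

/-- The projective dimension of `x` relative to `H`: the least integer `n` such that
`Hom(x, y[k]) = 0` for all `y` in `H` and all `k > n`. It is `⊤` (that is, `∞`) if there is no
such integer, and `⊥` (that is, `-∞`) if every integer is one, as is the case for `x = 0`. -/
def pd (H : ObjectProperty T) (x : T) : WithBot (WithTop ℤ) :=
  sInf {e | ∃ n : ℤ, e = ((n : WithTop ℤ) : WithBot (WithTop ℤ)) ∧ HomVanishesAbove H x n}

end Orthogonals

section Coproducts

variable {T : Type u} [Category.{v} T] [HasCoproducts.{v} T]

/-- `Add M`: the summands of small coproducts of copies of `M`. -/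
def addClosure (M : T) : ObjectProperty T :=
  fun x => ∃ J : Type v, Nonempty (Retract x (∐ fun _ : J => M))

variable [Preadditive T]

open Classical in
/-- The canonical map `⨁ Hom(c, X j) → Hom(c, ∐ X j)`. -/
def homCoproductComparison (c : T) {J : Type v} (X : J → T) :
    DirectSum J (fun j => c ⟶ X j) →+ (c ⟶ ∐ X) :=
  DirectSum.toAddMonoid fun j => Preadditive.rightComp c (Sigma.ι X j)

/-- The subcategory `T^c` of the compact objects: the objects `c` such that `Hom(c, -)` commutes
with small coproducts. -/
def compact (T : Type u) [Category.{v} T] [HasCoproducts.{v} T] [Preadditive T] :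
    ObjectProperty T :=
  fun c => ∀ (J : Type v) (X : J → T), Function.Bijective (homCoproductComparison c X)

/-- A triangulated category with small coproducts is compactly generated if there is a (small) set
of compact objects such that an object `x` with `Hom(G i, x[n]) = 0` for all `i` and `n`
is zero. -/
def IsCompactlyGenerated (T : Type u) [Category.{v} T] [HasCoproducts.{v} T] [Preadditive T]
    [HasShift T ℤ] : Prop :=
  ∃ (ι : Type v) (G : ι → T), (∀ i, compact T (G i)) ∧
    ∀ x : T, (∀ (i : ι) (n : ℤ) (f : G i ⟶ x⟦n⟧), f = 0) → IsZero x

/-- The subcategory `T^b` of the bounded objects. -/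
def bounded (T : Type u) [Category.{v} T] [HasCoproducts.{v} T] [Preadditive T]
    [HasShift T ℤ] : ObjectProperty T :=
  rightFarOrthogonal (compact T)

end Coproducts

section Triangulated

variable {T : Type u} [Category.{v} T] [Preadditive T] [HasZeroObject T] [HasShift T ℤ]
  [∀ n : ℤ, (shiftFunctor T n).Additive] [Pretriangulated T]

/-- `M` is a compact silting object: `Hom(M, M[i]) = 0` for `i > 0`, and the thick subcategory
generated by `M` is the subcategory of the compact objects. -/
structure IsCompactSilting [HasCoproducts.{v} T] (M : T) : Prop where
  hom_shift_eq_zero : ∀ i : ℤ, 0 < i → ∀ f : M ⟶ M⟦i⟧, f = 0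
  thick_eq_compact : (ObjectProperty.singleton M).triangEnvelope = compact T

/-- `P 0 ∗ P 1 ∗ ⋯ ∗ P d`, where `P ∗ Q` consists of the objects `t` in a distinguished triangle
`p ⟶ t ⟶ q ⟶ p[1]` with `p` in `P` and `q` in `Q`. The operation `∗` is associative in a
triangulated category, and the brackets are placed on the right here. -/
def iteratedStar : (ℕ → ObjectProperty T) → ℕ → ObjectProperty T
  | P, 0 => P 0
  | P, d + 1 => ObjectProperty.extensionProduct (P 0) (iteratedStar (fun i => P (i + 1)) d)

end Triangulated

end SiltingPd

end

set_option linter.unusedSectionVars false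

/-! Put `c i = M[i]` and let `InHeart c k` describe the shifted heart `H[k]`, so that (ii) says
`Hom(x, y) = 0` for all `y` in `H[k]`, `k > d`. Since `Hom(M[i], H[k]) = 0` for `i ≠ k`, (i) gives
(ii) by dévissage along the filtration (`homVanishes_of_iteratedStar`).

For the converse, let `P` be a coproduct of copies of `M` mapping onto every morphism `M ⟶ x`. The
cone of `P ⟶ x` lies one step deeper in the aisle and satisfies the same vanishing condition, so
induction peels off one layer at a time (`iteratedStar_of_homVanishes`). The base case `d = 0` is
`addClosure_of_homVanishes`. The truncations of `P` and `x` into the heart form an epimorphism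
there; its kernel, shifted, receives no morphism from `x`, so the truncation map of `x` lifts. The
lift yields an idempotent of `P` whose image is isomorphic to `x`. Truncations (`exists_truncation`)
and images of idempotents (`exists_split`) are built as homotopy colimits (`exists_hocolim`). -/

namespace SiltingPd

section Exactness

variable {T : Type u} [Category.{v} T] [Preadditive T] [HasZeroObject T] [HasShift T ℤ]
  [∀ n : ℤ, (shiftFunctor T n).Additive] [Pretriangulated T]
  {A B C : T} {f : A ⟶ B} {g : B ⟶ C} {h : C ⟶ A⟦(1 : ℤ)⟧}

lemma dist_yoneda₂ (H : Triangle.mk f g h ∈ distTriang T) {Y : T}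
    (k : B ⟶ Y) (hk : f ≫ k = 0) : ∃ t : C ⟶ Y, k = g ≫ t :=
  Triangle.yoneda_exact₂ _ H k hk

lemma dist_yoneda₃ (H : Triangle.mk f g h ∈ distTriang T) {Y : T}
    (k : C ⟶ Y) (hk : g ≫ k = 0) : ∃ t : A⟦(1 : ℤ)⟧ ⟶ Y, k = h ≫ t :=
  Triangle.yoneda_exact₃ _ H k hk

lemma dist_coyoneda₂ (H : Triangle.mk f g h ∈ distTriang T) {Y : T}
    (k : Y ⟶ B) (hk : k ≫ g = 0) : ∃ t : Y ⟶ A, k = t ≫ f :=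
  Triangle.coyoneda_exact₂ _ H k hk

lemma dist_coyoneda₃ (H : Triangle.mk f g h ∈ distTriang T) {Y : T}
    (k : Y ⟶ C) (hk : k ≫ h = 0) : ∃ t : Y ⟶ B, k = t ≫ g :=
  Triangle.coyoneda_exact₃ _ H k hk

end Exactness

/-! ### Morphisms from a compact object to a coproduct. -/

section Compact

variable {T : Type u} [Category.{v} T] [HasCoproducts.{v} T] [Preadditive T]

lemma compact.exists_eq_sum {c : T} (hc : compact T c) {J : Type v} (X : J → T) (b : c ⟶ ∐ X) :
    ∃ (s : Finset J) (g : ∀ j, c ⟶ X j), b = ∑ j ∈ s, g j ≫ Sigma.ι X j := by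
  classical
  obtain ⟨a, rfl⟩ := (hc J X).2 b
  induction a using DirectSum.induction_on with
  | zero => exact ⟨∅, fun _ => 0, by simp⟩
  | of i x =>
    refine ⟨{i}, fun j => if h : i = j then x ≫ eqToHom (by rw [h]) else 0, ?_⟩
    simp only [homCoproductComparison, Finset.sum_singleton, dite_true, eqToHom_refl,
      Category.comp_id]
    exact DirectSum.toAddMonoid_of _ _ _
  | add x y hx hy =>
    obtain ⟨s, g, hs⟩ := hx
    obtain ⟨t, g', ht⟩ := hy
    refine ⟨s ∪ t, fun j => (if j ∈ s then g j else 0) + (if j ∈ t then g' j else 0), ?_⟩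
    rw [map_add, hs, ht]
    simp only [Preadditive.add_comp, Finset.sum_add_distrib]
    congr 1
    · rw [← Finset.sum_subset Finset.subset_union_left (fun j _ hj => by simp [hj])]
      exact Finset.sum_congr rfl fun j hj => by simp [hj]
    · rw [← Finset.sum_subset Finset.subset_union_right (fun j _ hj => by simp [hj])]
      exact Finset.sum_congr rfl fun j hj => by simp [hj]

lemma compact.hom_sigma_eq_zero {c : T} (hc : compact T c) {J : Type v} (X : J → T)
    (h : ∀ j (f : c ⟶ X j), f = 0) (b : c ⟶ ∐ X) : b = 0 := by
  obtain ⟨s, g, rfl⟩ := hc.exists_eq_sum X b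
  exact Finset.sum_eq_zero fun j _ => by rw [h j (g j), zero_comp]

end Compact

/-! ### The telescope of a sequence and its homotopy colimit. -/

section Telescope

variable {T : Type u} [Category.{v} T] [HasCoproducts.{v} T] [Preadditive T]
  (X : ℕ → T) (φ : ∀ k, X k ⟶ X (k + 1))

/-- The coproduct of a sequence of objects. -/
noncomputable abbrev seqSigma : T := ∐ fun j : ULift.{v} ℕ => X j.down

/-- The inclusions into the coproduct of a sequence. -/
noncomputable def seqι (k : ℕ) : X k ⟶ seqSigma X :=
  Sigma.ι (fun j : ULift.{v} ℕ => X j.down) ⟨k⟩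

/-- The projections from the coproduct of a sequence. -/
noncomputable def seqπ (k : ℕ) : seqSigma X ⟶ X k :=
  Sigma.desc fun j : ULift.{v} ℕ =>
    if h : j.down = k then eqToHom (congrArg X h) else 0

/-- The morphism `1 - shift` whose cone is the homotopy colimit of a sequence. -/
noncomputable def telescope : seqSigma X ⟶ seqSigma X :=
  Sigma.desc fun j : ULift.{v} ℕ => seqι X j.down - φ j.down ≫ seqι X (j.down + 1)

lemma seqSigma_hom_ext {Y : T} {f g : seqSigma X ⟶ Y}
    (h : ∀ k, seqι X k ≫ f = seqι X k ≫ g) : f = g :=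
  Sigma.hom_ext _ _ fun j => h j.down

@[simp]
lemma seqι_π_self (k : ℕ) : seqι X k ≫ seqπ X k = 𝟙 _ := by
  simp [seqι, seqπ]

lemma seqι_π_of_ne {j k : ℕ} (h : j ≠ k) : seqι X j ≫ seqπ X k = 0 := by
  simp [seqι, seqπ, h]

@[simp]
lemma seqι_telescope (k : ℕ) :
    seqι X k ≫ telescope X φ = seqι X k - φ k ≫ seqι X (k + 1) := by
  rw [telescope, seqι, Sigma.ι_desc]
  rfl

lemma telescope_π_zero : telescope X φ ≫ seqπ X 0 = seqπ X 0 := by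
  refine seqSigma_hom_ext X fun k => ?_
  rw [← Category.assoc, seqι_telescope, Preadditive.sub_comp, Category.assoc,
    seqι_π_of_ne X (Nat.succ_ne_zero k), comp_zero, sub_zero]

lemma telescope_π_succ (k : ℕ) :
    telescope X φ ≫ seqπ X (k + 1) = seqπ X (k + 1) - seqπ X k ≫ φ k := by
  refine seqSigma_hom_ext X fun j => ?_
  rw [← Category.assoc, seqι_telescope, Preadditive.sub_comp, Category.assoc,
    Preadditive.comp_sub]
  congr 1
  by_cases h : j = k
  · subst h
    rw [seqι_π_self, Category.comp_id, ← Category.assoc, seqι_π_self, Category.id_comp]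
  · rw [seqι_π_of_ne X (by simpa using h), comp_zero, ← Category.assoc, seqι_π_of_ne X h,
      zero_comp]

variable {X}

lemma compact.exists_bound {c : T} (hc : compact T c) (b : c ⟶ seqSigma X) :
    ∃ N, ∀ k, N ≤ k → b ≫ seqπ X k = 0 := by
  obtain ⟨s, g, rfl⟩ := hc.exists_eq_sum _ b
  refine ⟨s.sup (fun j => j.down + 1), fun k hk => ?_⟩
  rw [Preadditive.sum_comp]
  refine Finset.sum_eq_zero fun j hj => ?_
  have : j.down + 1 ≤ k := (Finset.le_sup (f := fun j : ULift.{v} ℕ => j.down + 1) hj).trans hk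
  rw [Category.assoc]
  exact (congrArg (g j ≫ ·) (seqι_π_of_ne X (by lia : j.down ≠ k))).trans comp_zero

lemma compact.seq_hom_ext {c : T} (hc : compact T c) (b : c ⟶ seqSigma X)
    (h : ∀ k, b ≫ seqπ X k = 0) : b = 0 := by
  classical
  obtain ⟨s, g, rfl⟩ := hc.exists_eq_sum _ b
  refine Finset.sum_eq_zero fun j hj => ?_
  have hj' := h j.down
  rw [Preadditive.sum_comp, Finset.sum_eq_single j] at hj'
  · rw [Category.assoc] at hj'
    have : g j = 0 := by
      rw [← hj']
      exact ((congrArg (g j ≫ ·) (seqι_π_self X j.down)).trans (Category.comp_id _)).symm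
    rw [this, zero_comp]
  · intro i _ hij
    rw [Category.assoc]
    exact (congrArg (g i ≫ ·)
      (seqι_π_of_ne X (fun h => hij (ULift.ext _ _ h)))).trans comp_zero
  · exact fun h => absurd hj h

/-- The coordinates of `b` satisfy `b₀ = 0` and `bₖ₊₁ = bₖ ≫ φ k`, so they all vanish. -/
lemma compact.eq_zero_of_comp_telescope {c : T} (hc : compact T c) (b : c ⟶ seqSigma X)
    (h : b ≫ telescope X φ = 0) : b = 0 := by
  refine hc.seq_hom_ext b fun k => ?_
  induction k with
  | zero => rw [← telescope_π_zero X φ, ← Category.assoc, h, zero_comp]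
  | succ k ih =>
    have := telescope_π_succ X φ k
    rw [eq_sub_iff_add_eq] at this
    rw [← this, Preadditive.comp_add, ← Category.assoc, h, zero_comp, ← Category.assoc, ih,
      zero_comp, add_zero]

/-- Now `b₀ = a` and `bₖ₊₁ = bₖ ≫ φ k`. By compactness some `b_N` is zero, and injectivity along the
`φ k` carries this back to `b₀`. -/
lemma compact.eq_zero_of_comp_telescope_eq {c : T} (hc : compact T c)
    (hφ : ∀ k (a : c ⟶ X k), a ≫ φ k = 0 → a = 0) (a : c ⟶ X 0) (b : c ⟶ seqSigma X)
    (h : b ≫ telescope X φ = a ≫ seqι X 0) : a = 0 := by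
  have h0 : b ≫ seqπ X 0 = a := by
    rw [← telescope_π_zero X φ, ← Category.assoc, h, Category.assoc, seqι_π_self,
      Category.comp_id]
  have hs : ∀ k, b ≫ seqπ X (k + 1) = (b ≫ seqπ X k) ≫ φ k := fun k => by
    have := telescope_π_succ X φ k
    rw [eq_sub_iff_add_eq] at this
    rw [← this, Preadditive.comp_add, ← Category.assoc, h, Category.assoc a,
      seqι_π_of_ne X (Nat.succ_ne_zero k).symm, comp_zero, zero_add, Category.assoc]
  obtain ⟨N, hN⟩ := hc.exists_bound b
  have hz : b ≫ seqπ X N = 0 := hN N le_rfl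
  rw [← h0]
  clear hN
  induction N with
  | zero => exact hz
  | succ N ih => exact ih (hφ N _ (by rw [← hs, hz]))

end Telescope

section Hocolim

variable {T : Type u} [Category.{v} T] [Preadditive T] [HasZeroObject T] [HasShift T ℤ]
  [∀ n : ℤ, (shiftFunctor T n).Additive] [Pretriangulated T] [HasCoproducts.{v} T]

/-- Homotopy colimits of sequences: they are weak colimits, and morphisms from compact objects
behave as for honest colimits. -/
theorem exists_hocolim (X : ℕ → T) (φ : ∀ k, X k ⟶ X (k + 1)) :
    ∃ (L : T) (ι : ∀ k, X k ⟶ L), (∀ k, φ k ≫ ι (k + 1) = ι k) ∧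
      (∀ (Y : T) (g : ∀ k, X k ⟶ Y), (∀ k, φ k ≫ g (k + 1) = g k) →
        ∃ t : L ⟶ Y, ∀ k, ι k ≫ t = g k) ∧
      (∀ c c' : T, (c⟦(1 : ℤ)⟧ ≅ c') → compact T c → compact T c' →
        ∀ b : c' ⟶ L, ∃ k, ∃ a : c' ⟶ X k, b = a ≫ ι k) ∧
      (∀ c : T, compact T c → (∀ k (a : c ⟶ X k), a ≫ φ k = 0 → a = 0) →
        ∀ a : c ⟶ X 0, a ≫ ι 0 = 0 → a = 0) := by
  obtain ⟨L, q, δ, hL⟩ := distinguished_cocone_triangle (telescope X φ)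
  have hq : ∀ k, φ k ≫ seqι X (k + 1) ≫ q = seqι X k ≫ q := fun k => by
    have h : telescope X φ ≫ q = 0 := comp_distTriang_mor_zero₁₂ _ hL
    have := seqι X k ≫= h
    rw [← Category.assoc, seqι_telescope, comp_zero, Preadditive.sub_comp, Category.assoc,
      sub_eq_zero] at this
    exact this.symm
  refine ⟨L, fun k => seqι X k ≫ q, hq, ?_, ?_, ?_⟩
  · intro Y g hg
    let G : seqSigma X ⟶ Y := Sigma.desc fun j : ULift.{v} ℕ => g j.down
    have hG : ∀ k, seqι X k ≫ G = g k := fun k => Sigma.ι_desc _ _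
    obtain ⟨t, ht⟩ := dist_yoneda₂ hL G (by
      refine seqSigma_hom_ext X fun k => ?_
      rw [← Category.assoc, seqι_telescope, Preadditive.sub_comp, Category.assoc, hG, hG, hg,
        sub_self, comp_zero])
    refine ⟨t, fun k => ?_⟩
    rw [← hG, ht, Category.assoc]
  · intro c c' i hc' hc b
    -- The connecting map vanishes on `c' ≅ c[1]` because `1 - shift` is injective on morphisms from
    -- `c`; hence `b` comes from the coproduct, and from a single stage since the sum is finite.
    have hb : b ≫ δ = 0 := by
      obtain ⟨b', hb'⟩ := (shiftFunctor T (1 : ℤ)).map_surjective (i.hom ≫ b ≫ δ)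
      rw [← cancel_epi i.hom, ← hb', comp_zero]
      have h0 : b' = 0 := hc'.eq_zero_of_comp_telescope φ b' (by
        apply (shiftFunctor T (1 : ℤ)).map_injective
        have h : δ ≫ (telescope X φ)⟦(1 : ℤ)⟧' = 0 := comp_distTriang_mor_zero₃₁ _ hL
        rw [Functor.map_comp, hb', Category.assoc, Category.assoc, h, comp_zero,
          comp_zero, Functor.map_zero])
      rw [h0, Functor.map_zero]
    obtain ⟨b', rfl⟩ := dist_coyoneda₃ hL b hb
    obtain ⟨s, g, rfl⟩ := hc.exists_eq_sum _ b'
    have key : ∀ (k m : ℕ), k ≤ m → ∀ a : c' ⟶ X k,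
        ∃ a' : c' ⟶ X m, a ≫ seqι X k ≫ q = a' ≫ seqι X m ≫ q := by
      intro k m hkm a
      induction m, hkm using Nat.le_induction with
      | base => exact ⟨a, rfl⟩
      | succ m _ ih =>
        obtain ⟨a', ha'⟩ := ih
        exact ⟨a' ≫ φ m, by rw [ha', Category.assoc, hq]⟩
    refine ⟨s.sup (fun j => j.down), ?_⟩
    choose! g' hg' using fun (j : ULift.{v} ℕ) (hj : j ∈ s) => key j.down (s.sup (fun j => j.down))
      (Finset.le_sup (f := fun j : ULift.{v} ℕ => j.down) hj) (g j)
    refine ⟨∑ j ∈ s, g' j, ?_⟩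
    rw [Preadditive.sum_comp, Preadditive.sum_comp]
    refine Finset.sum_congr rfl fun j hj => ?_
    rw [← hg' j hj, Category.assoc]
    rfl
  · intro c hc hφ a ha
    obtain ⟨b, hb⟩ := dist_coyoneda₂ hL (a ≫ seqι X 0)
      (by rw [← ha, Category.assoc])
    exact hc.eq_zero_of_comp_telescope_eq φ hφ a b hb.symm

end Hocolim

/-! ### Calculus of vanishing Hom groups. -/

section Vanishing

variable {T : Type u} [Category.{v} T] [Preadditive T]

/-- There are no nonzero morphisms from `a` to `y`. -/
def HomVanishes (a y : T) : Prop := ∀ f : a ⟶ y, f = 0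

lemma HomVanishes.of_iso {a a' y y' : T} (h : HomVanishes a y) (e : a ≅ a') (e' : y ≅ y') :
    HomVanishes a' y' := fun f => by
  have := h (e.hom ≫ f ≫ e'.inv)
  rw [← cancel_epi e.hom, ← cancel_mono e'.inv, Category.assoc, this, comp_zero, zero_comp]

lemma HomVanishes.of_retract {a a' y : T} (h : HomVanishes a y) (r : Retract a' a) :
    HomVanishes a' y := fun f => by
  rw [← Category.id_comp f, ← r.retract, Category.assoc, h (r.r ≫ f), comp_zero]

lemma HomVanishes.to_retract {a y y' : T} (h : HomVanishes a y) (r : Retract y' y) :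
    HomVanishes a y' := fun f => by
  rw [← Category.comp_id f, ← r.retract, ← Category.assoc, h (f ≫ r.i), zero_comp]

lemma HomVanishes.sigma [HasCoproducts.{v} T] {J : Type v} {X : J → T} {y : T}
    (h : ∀ j, HomVanishes (X j) y) : HomVanishes (∐ X) y := fun f =>
  Sigma.hom_ext _ _ fun j => by rw [h j (Sigma.ι X j ≫ f), comp_zero]

lemma homVanishes_shift_iff [HasShift T ℤ] [∀ n : ℤ, (shiftFunctor T n).Additive]
    (a y : T) (n : ℤ) : HomVanishes (a⟦n⟧) (y⟦n⟧) ↔ HomVanishes a y := by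
  constructor
  · intro h f
    apply (shiftFunctor T n).map_injective
    exact (h _).trans (Functor.map_zero ..).symm
  · intro h f
    obtain ⟨f, rfl⟩ := (shiftFunctor T n).map_surjective f
    rw [h f, Functor.map_zero]

end Vanishing

/-! ### Silting families: split idempotents and truncation. -/

variable {T : Type u} [Category.{v} T] [Preadditive T] [HasZeroObject T] [HasShift T ℤ]
  [∀ n : ℤ, (shiftFunctor T n).Additive] [Pretriangulated T] [HasCoproducts.{v} T]

/-- The family of all shifts of a compact silting object, up to isomorphism. -/
structure IsSiltingFamily (c : ℤ → T) : Prop where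
  compact_obj : ∀ n, compact T (c n)
  homVanishes_of_lt : ∀ i j, i < j → HomVanishes (c i) (c j)
  isZero : ∀ y, (∀ n, HomVanishes (c n) y) → IsZero y
  shiftIso : ∀ n, Nonempty ((c n)⟦(1 : ℤ)⟧ ≅ c (n + 1))

/-- The objects of the `n`-th shift of the heart of a silting family. -/
def InHeart (c : ℤ → T) (n : ℤ) (y : T) : Prop := ∀ i, i ≠ n → HomVanishes (c i) y

namespace IsSiltingFamily

variable {c : ℤ → T} (hc : IsSiltingFamily c)

include hc

lemma homVanishes_shift_one_iff (n : ℤ) (y : T) :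
    HomVanishes (c (n + 1)) (y⟦(1 : ℤ)⟧) ↔ HomVanishes (c n) y := by
  obtain ⟨e⟩ := hc.shiftIso n
  rw [← homVanishes_shift_iff (c n) y 1]
  exact ⟨fun h => h.of_iso e.symm (Iso.refl _), fun h => h.of_iso e (Iso.refl _)⟩

lemma homVanishes_shift_one_iff' (n : ℤ) (y : T) :
    HomVanishes (c n) (y⟦(1 : ℤ)⟧) ↔ HomVanishes (c (n - 1)) y := by
  simpa using hc.homVanishes_shift_one_iff (n - 1) y

lemma injective_shift {n : ℤ} {A B : T} {f : A ⟶ B}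
    (hf : ∀ a : c (n - 1) ⟶ A, a ≫ f = 0 → a = 0) (a : c n ⟶ A⟦(1 : ℤ)⟧)
    (ha : a ≫ f⟦(1 : ℤ)⟧' = 0) : a = 0 := by
  obtain ⟨e⟩ := hc.shiftIso (n - 1)
  rw [sub_add_cancel] at e
  obtain ⟨a', ha'⟩ := (shiftFunctor T (1 : ℤ)).map_surjective (e.hom ≫ a)
  rw [← cancel_epi e.hom, ← ha', comp_zero, hf a', Functor.map_zero]
  apply (shiftFunctor T (1 : ℤ)).map_injective
  rw [Functor.map_comp, ha', Category.assoc, ha, comp_zero, Functor.map_zero]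

lemma homVanishes_cone {A B C : T} {f : A ⟶ B} {g : B ⟶ C} {h : C ⟶ A⟦(1 : ℤ)⟧}
    (H : Triangle.mk f g h ∈ distTriang T) {n : ℤ}
    (hinj : ∀ a : c (n - 1) ⟶ A, a ≫ f = 0 → a = 0)
    (hsurj : ∀ b : c n ⟶ B, ∃ a : c n ⟶ A, b = a ≫ f) : HomVanishes (c n) C := fun t => by
  have hf : h ≫ f⟦(1 : ℤ)⟧' = 0 := comp_distTriang_mor_zero₃₁ _ H
  have hfg : f ≫ g = 0 := comp_distTriang_mor_zero₁₂ _ H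
  obtain ⟨b, rfl⟩ := dist_coyoneda₃ H t
    (hc.injective_shift hinj _ (by rw [Category.assoc, hf, comp_zero]))
  obtain ⟨a, rfl⟩ := hsurj b
  rw [Category.assoc, hfg, comp_zero]

lemma isIso_of_bijective {A B : T} (f : A ⟶ B)
    (hinj : ∀ n, ∀ a : c n ⟶ A, a ≫ f = 0 → a = 0)
    (hsurj : ∀ n, ∀ b : c n ⟶ B, ∃ a : c n ⟶ A, b = a ≫ f) : IsIso f := by
  obtain ⟨C, g, h, H⟩ := distinguished_cocone_triangle f
  exact (Triangle.isZero₃_iff_isIso₁ _ H).1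
    (hc.isZero _ fun n => hc.homVanishes_cone H (hinj _) (hsurj n))

lemma homVanishes_sigma {n : ℤ} {J : Type v} {X : J → T} (h : ∀ j, HomVanishes (c n) (X j)) :
    HomVanishes (c n) (∐ X) :=
  (hc.compact_obj n).hom_sigma_eq_zero X h

/-- The image is the homotopy colimit of `P ⟶ P ⟶ ⋯` along `e`. The composite `r ≫ ι 0` is the
identity on morphisms from every `c n`, hence invertible; being idempotent, it is the identity. -/
lemma exists_split (P : T) (e : P ⟶ P) (he : e ≫ e = e) :
    ∃ (L : T) (r : L ⟶ P) (γ : P ⟶ L), γ ≫ r = e ∧ r ≫ γ = 𝟙 L := by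
  obtain ⟨L, ι, hι, hdesc, hsurj, -⟩ := exists_hocolim (fun _ : ℕ => P) (fun _ => e)
  have h1 : ∀ k, e ≫ ι k = ι k := fun k => by
    rw [← hι k, ← Category.assoc, he]
  have h2 : ∀ k, ι k = ι 0 := fun k => by
    induction k with
    | zero => rfl
    | succ k ih => rw [← ih, ← hι k, h1]
  obtain ⟨r, hr⟩ := hdesc P (fun _ => e) (fun _ => he)
  have key : ∀ n (b : c n ⟶ L), b ≫ r ≫ ι 0 = b := fun n b => by
    obtain ⟨i⟩ := hc.shiftIso (n - 1)
    rw [sub_add_cancel] at i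
    obtain ⟨k, a, rfl⟩ := hsurj _ _ i (hc.compact_obj _) (hc.compact_obj _) b
    rw [h2 k, Category.assoc, ← Category.assoc (ι 0), hr, h1]
  have : IsIso (r ≫ ι 0) := hc.isIso_of_bijective _
    (fun n a ha => by rw [← key n a, ha]) (fun n b => ⟨b, (key n b).symm⟩)
  refine ⟨L, r, ι 0, hr 0, ?_⟩
  rw [← cancel_epi (r ≫ ι 0), Category.comp_id, Category.assoc, ← Category.assoc (ι 0), hr, h1]

/-- Cone off all morphisms from the `c i`, `i > n`. For `i ≤ n` nothing changes, as `c i` has no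
morphisms to the coproduct or its shift. New morphisms from higher `c i` may appear, so the step has
to be iterated. -/
lemma exists_truncation_step (n : ℤ) (z : T) :
    ∃ (z' : T) (φ : z ⟶ z'), (∀ i, n < i → ∀ a : c i ⟶ z, a ≫ φ = 0) ∧
      (∀ i, i ≤ n → ∀ a : c i ⟶ z, a ≫ φ = 0 → a = 0) ∧
      (∀ i, i ≤ n → ∀ b : c i ⟶ z', ∃ a : c i ⟶ z, b = a ≫ φ) ∧
      (∀ y, (∀ i, n < i → HomVanishes (c i) y) → ∀ g : z ⟶ y, ∃ g' : z' ⟶ y, g = φ ≫ g') := by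
  let J := Σ i : {i : ℤ // n < i}, c i ⟶ z
  let p : (∐ fun j : J => c j.1) ⟶ z := Sigma.desc fun j => j.2
  obtain ⟨z', φ, δ, H⟩ := distinguished_cocone_triangle p
  have hp : p ≫ φ = 0 := comp_distTriang_mor_zero₁₂ _ H
  have hP : ∀ i, i ≤ n → HomVanishes (c i) (∐ fun j : J => c j.1) := fun i hi =>
    hc.homVanishes_sigma fun j => hc.homVanishes_of_lt _ _ (hi.trans_lt j.1.2)
  refine ⟨z', φ, fun i hi a => ?_, fun i hi a ha => ?_, fun i hi b => ?_, fun y hy g => ?_⟩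
  · have : a = Sigma.ι (fun j : J => c j.1) ⟨⟨i, hi⟩, a⟩ ≫ p :=
      (Sigma.ι_desc (fun j : J => j.2) ⟨⟨i, hi⟩, a⟩).symm
    rw [this, Category.assoc, hp, comp_zero]
  · obtain ⟨t, rfl⟩ := dist_coyoneda₂ H a ha
    rw [hP i hi t, zero_comp]
  · exact dist_coyoneda₃ H b ((hc.homVanishes_shift_one_iff' _ _).2 (hP _ (by lia)) _)
  · exact dist_yoneda₂ H g (HomVanishes.sigma (fun j => hy _ j.1.2) _)

/-- Truncation with respect to the t-structure of a silting family. -/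
theorem exists_truncation (n : ℤ) (z : T) :
    ∃ (h : T) (w : z ⟶ h), (∀ i, n < i → HomVanishes (c i) h) ∧
      (∀ i, i ≤ n → ∀ a : c i ⟶ z, a ≫ w = 0 → a = 0) ∧
      (∀ i, i ≤ n → ∀ b : c i ⟶ h, ∃ a : c i ⟶ z, b = a ≫ w) ∧
      (∀ y, (∀ i, n < i → HomVanishes (c i) y) → ∀ g : z ⟶ y, ∃ g' : h ⟶ y, g = w ≫ g') := by
  choose N φ hkill hinj hsurj hext using hc.exists_truncation_step n
  let X : ℕ → T := fun k => Nat.rec z (fun _ w => N w) k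
  let ψ : ∀ k, X k ⟶ X (k + 1) := fun k => φ (X k)
  obtain ⟨h, ι, hι, hdesc, hfac, hker⟩ := exists_hocolim X ψ
  have hfac' : ∀ i (b : c i ⟶ h), ∃ k, ∃ a : c i ⟶ X k, b = a ≫ ι k := fun i b => by
    obtain ⟨e⟩ := hc.shiftIso (i - 1)
    rw [sub_add_cancel] at e
    exact hfac _ _ e (hc.compact_obj _) (hc.compact_obj _) b
  refine ⟨h, ι 0, fun i hi b => ?_, fun i hi => ?_, fun i hi b => ?_, fun y hy g => ?_⟩
  · obtain ⟨k, a, rfl⟩ := hfac' i b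
    rw [← hι k, ← Category.assoc, hkill (X k) i hi a, zero_comp]
  · exact hker (c i) (hc.compact_obj i) fun k => hinj (X k) i hi
  · obtain ⟨k, a, rfl⟩ := hfac' i b
    induction k with
    | zero => exact ⟨a, rfl⟩
    | succ k ih =>
      obtain ⟨a', rfl⟩ := hsurj (X k) i hi a
      obtain ⟨a'', ha''⟩ := ih a'
      exact ⟨a'', by rw [← ha'', Category.assoc]; exact congrArg (a' ≫ ·) (hι k)⟩
  · let G : ∀ k, X k ⟶ y := fun k =>
      Nat.rec (motive := fun k => X k ⟶ y) g (fun k gk => (hext (X k) y hy gk).choose) k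
    obtain ⟨t, ht⟩ := hdesc y G fun k => (hext (X k) y hy (G k)).choose_spec.symm
    exact ⟨t, (ht 0).symm⟩

end IsSiltingFamily

lemma addClosure.homVanishes {a x y : T} (hx : addClosure a x) (h : HomVanishes a y) :
    HomVanishes x y := by
  obtain ⟨J, ⟨r⟩⟩ := hx
  exact (HomVanishes.sigma fun _ => h).of_retract r

lemma addClosure_add_one_add (c : ℤ → T) (n : ℤ) :
    (fun j : ℕ => addClosure (c (n + 1 + j))) =
      fun j : ℕ => addClosure (c (n + ((j + 1 : ℕ) : ℤ))) := by
  funext j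
  rw [show n + 1 + (j : ℤ) = n + ((j + 1 : ℕ) : ℤ) by push_cast; ring]

/-! ### From vanishing against the hearts to the filtration. -/

namespace IsSiltingFamily

variable {c : ℤ → T} (hc : IsSiltingFamily c)

include hc

lemma exists_inHeart_shift {n : ℤ} {y : T} (hy : InHeart c n y) :
    ∃ y', InHeart c (n - 1) y' ∧ Nonempty (y'⟦(1 : ℤ)⟧ ≅ y) := by
  refine ⟨(shiftFunctor T (1 : ℤ)).objPreimage y, fun i hi => ?_,
    ⟨(shiftFunctor T (1 : ℤ)).objObjPreimageIso y⟩⟩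
  rw [← hc.homVanishes_shift_one_iff]
  exact (hy (i + 1) (by lia)).of_iso (Iso.refl _) ((shiftFunctor T (1 : ℤ)).objObjPreimageIso y).symm

/-- An object without nonzero morphisms to the hearts of index `> n` is zero if it
receives no nonzero morphism from `c i` for `i ≤ n`. -/
lemma isZero_of_homVanishes_inHeart {n : ℤ} {C : T} (hC : ∀ i, i ≤ n → HomVanishes (c i) C)
    (h : ∀ k, n < k → ∀ y, InHeart c k y → HomVanishes C y) : IsZero C := by
  -- Climb one index at a time: once the lower Homs vanish, the truncation at `n + m + 1` lies in
  -- that heart, so the truncation map is zero by `h`; it is injective on morphisms from `c (n + m +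
  -- 1)`.
  have key : ∀ m : ℕ, ∀ i, i ≤ n + m → HomVanishes (c i) C := fun m => by
    induction m with
    | zero => exact fun i hi => hC i (by simpa using hi)
    | succ m ih =>
      intro i hi
      obtain hi | rfl : i ≤ n + m ∨ i = n + m + 1 := by lia
      · exact ih i hi
      obtain ⟨y, w, hy, hinj, hsurj, -⟩ := hc.exists_truncation (n + m + 1) C
      have hw : w = 0 := h (n + m + 1) (by lia) y (fun i hi => by
        obtain hi | hi := lt_or_gt_of_ne hi
        · intro b
          obtain ⟨a, rfl⟩ := hsurj i hi.le b
          rw [ih i (by lia) a, zero_comp]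
        · exact hy i hi) w
      exact fun a => hinj _ le_rfl a (by rw [hw, comp_zero])
  exact hc.isZero C fun i => key (i - n).toNat i (by lia)

/-- An object of the aisle is a direct summand of a coproduct of copies of `c n` if it has no
morphisms to the hearts of index `> n`. -/
theorem addClosure_of_homVanishes {n : ℤ} {x : T} (hx : ∀ i, i < n → HomVanishes (c i) x)
    (hxy : ∀ k, n < k → ∀ y, InHeart c k y → HomVanishes x y) : addClosure (c n) x := by
  let P : T := ∐ fun _ : c n ⟶ x => c n
  let p : P ⟶ x := Sigma.desc fun f => f
  have hP : ∀ i, i < n → HomVanishes (c i) P := fun i hi =>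
    hc.homVanishes_sigma fun _ => hc.homVanishes_of_lt i n hi
  have hp : ∀ a : c n ⟶ x, ∃ b : c n ⟶ P, a = b ≫ p := fun a =>
    ⟨Sigma.ι (fun _ : c n ⟶ x => c n) a, (Sigma.ι_desc (fun f : c n ⟶ x => f) a).symm⟩
  have hPext : ∀ {Y Z : T} (t : P ⟶ Y) (g : Y ⟶ Z), (∀ a : c n ⟶ Y, a ≫ g = 0 → a = 0) →
      t ≫ g = 0 → t = 0 := fun t g hg ht => by
    refine Sigma.hom_ext _ _ fun j => ?_
    rw [comp_zero]
    exact hg _ (by rw [Category.assoc, ht, comp_zero])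
  obtain ⟨h, u, hh, hu, hu', hue⟩ := hc.exists_truncation n P
  obtain ⟨h', w, hh', hw, hw', -⟩ := hc.exists_truncation n x
  obtain ⟨q, hq⟩ := hue h' hh' (p ≫ w)
  have hhH : InHeart c n h := fun i hi => by
    obtain hi | hi := lt_or_gt_of_ne hi
    · intro b
      obtain ⟨a, rfl⟩ := hu' i hi.le b
      rw [hP i hi a, zero_comp]
    · exact hh i hi
  have hhH' : InHeart c n h' := fun i hi => by
    obtain hi | hi := lt_or_gt_of_ne hi
    · intro b
      obtain ⟨a, rfl⟩ := hw' i hi.le b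
      rw [hx i hi a, zero_comp]
    · exact hh' i hi
  obtain ⟨D, g, δ, hD⟩ := distinguished_cocone_triangle q
  -- `q` is surjective on morphisms from `c n`, so its cone is concentrated in degree `n + 1`, where
  -- `x` has no morphisms; thus `w` lifts to `σ`.
  have hDH : InHeart c (n + 1) D := fun i hi => by
    refine hc.homVanishes_cone hD (fun a _ => hhH (i - 1) (by lia) a) fun b => ?_
    by_cases hin : i = n
    · subst hin
      obtain ⟨a, rfl⟩ := hw' i le_rfl b
      obtain ⟨a', rfl⟩ := hp a
      exact ⟨a' ≫ u, by rw [Category.assoc, Category.assoc, hq]⟩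
    · exact ⟨0, by rw [hhH' i hin b, zero_comp]⟩
  obtain ⟨σ, hσ⟩ := dist_coyoneda₂ hD w (hxy (n + 1) (by lia) D hDH _)
  obtain ⟨e, he⟩ : ∃ e : P ⟶ P, e ≫ u = p ≫ σ := by
    choose e he using fun f : c n ⟶ x => hu' n le_rfl (f ≫ σ)
    refine ⟨Sigma.desc e, Sigma.hom_ext _ _ fun f => ?_⟩
    rw [← Category.assoc, Sigma.ι_desc, ← he, ← Category.assoc]
    exact congrArg (· ≫ σ) (Sigma.ι_desc (fun f : c n ⟶ x => f) f).symm
  have hep : e ≫ p = p := by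
    rw [← sub_eq_zero]
    refine hPext _ w (hw n le_rfl) ?_
    rw [Preadditive.sub_comp, Category.assoc, hq, ← Category.assoc, he, Category.assoc, ← hσ,
      hq, sub_self]
  -- `u` is injective on morphisms from `P`, so idempotence can be tested after composing with `u`,
  -- where it reduces to `hep`.
  have hee : e ≫ e = e := by
    rw [← sub_eq_zero]
    refine hPext _ u (hu n le_rfl) ?_
    rw [Preadditive.sub_comp, Category.assoc, he, ← Category.assoc, hep, sub_self]
  obtain ⟨L, r, γ, hγr, hrγ⟩ := hc.exists_split P e hee
  let ret : Retract L P := ⟨r, γ, hrγ⟩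
  have hγp : γ ≫ r ≫ p = p := by rw [← Category.assoc, hγr, hep]
  obtain ⟨C, g', δ', hC⟩ := distinguished_cocone_triangle (r ≫ p)
  have hpg : (r ≫ p) ≫ g' = 0 := comp_distTriang_mor_zero₁₂ _ hC
  have hδp : δ' ≫ (r ≫ p)⟦(1 : ℤ)⟧' = 0 := comp_distTriang_mor_zero₃₁ _ hC
  have hCz : IsZero C := by
    refine hc.isZero_of_homVanishes_inHeart (n := n) (fun i hi => ?_) fun k hk y hy t => ?_
    · refine hc.homVanishes_cone hC (fun a _ => (hP (i - 1) (by lia)).to_retract ret a)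
        fun b => ?_
      obtain hi | rfl := hi.lt_or_eq
      · exact ⟨0, by rw [hx i hi b, zero_comp]⟩
      · obtain ⟨a, rfl⟩ := hp b
        exact ⟨a ≫ γ, by rw [Category.assoc, hγp]⟩
    · obtain ⟨s, rfl⟩ := dist_yoneda₃ hC t (hxy k hk y hy _)
      obtain ⟨y', hy', ⟨i⟩⟩ := hc.exists_inHeart_shift hy
      obtain ⟨s', hs'⟩ := (shiftFunctor T (1 : ℤ)).map_surjective (s ≫ i.inv)
      obtain ⟨s'', hs''⟩ : ∃ s'' : x ⟶ y', s' = (r ≫ p) ≫ s'' := by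
        -- Only `H[n]` can receive nonzero morphisms from `L`. There, `γ ≫ s'` factors through `u`,
        -- and `e ≫ u = p ≫ σ` turns this into a factorization through `x`.
        by_cases hkn : k - 1 = n
        · obtain ⟨v, hv⟩ := hue y' (fun i hi => hy' i (by lia)) (γ ≫ s')
          refine ⟨σ ≫ v, ?_⟩
          rw [Category.assoc, ← Category.assoc p, ← he, Category.assoc, ← hv, ← hγr,
            Category.assoc, ← Category.assoc r γ (s'), hrγ, Category.id_comp,
            ← Category.assoc, hrγ, Category.id_comp]
        · refine ⟨0, ?_⟩
          rw [comp_zero]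
          exact (HomVanishes.sigma fun _ => hy' n (Ne.symm hkn)).of_retract ret s'
      rw [← cancel_mono i.inv, Category.assoc, ← hs', hs'', Functor.map_comp, ← Category.assoc,
        hδp, zero_comp, zero_comp]
  have : IsIso (r ≫ p) := (Triangle.isZero₃_iff_isIso₁ _ hC).1 hCz
  exact ⟨_, ⟨(asIso (r ≫ p)).symm.retract.trans ret⟩⟩

theorem iteratedStar_of_homVanishes (d : ℕ) : ∀ (n : ℤ) (x : T),
    (∀ i, i < n → HomVanishes (c i) x) →
    (∀ k, n + d < k → ∀ y, InHeart c k y → HomVanishes x y) →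
    iteratedStar (fun j : ℕ => addClosure (c (n + j))) d x := by
  induction d with
  | zero =>
    intro n x hx hxy
    have := hc.addClosure_of_homVanishes hx fun k hk => hxy k (by simpa using hk)
    simpa [iteratedStar] using this
  | succ d ih =>
    intro n x hx hxy
    let P : T := ∐ fun _ : c n ⟶ x => c n
    let p : P ⟶ x := Sigma.desc fun f => f
    obtain ⟨C, g, δ, hC⟩ := distinguished_cocone_triangle p
    have hC' := ih (n + 1) C (fun i hi => ?_) fun k hk y hy t => ?_
    · refine ⟨P, C, p, g, δ, hC, ?_, ?_⟩
      · have : addClosure (c n) P := ⟨_, ⟨Retract.refl _⟩⟩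
        simpa only [Nat.cast_zero, add_zero] using this
      · rwa [addClosure_add_one_add] at hC'
    · refine hc.homVanishes_cone hC (fun a _ => hc.homVanishes_sigma
        (fun _ => hc.homVanishes_of_lt (i - 1) n (by lia)) a) fun b => ?_
      obtain hi | rfl : i < n ∨ i = n := by lia
      · exact ⟨0, by rw [hx i hi b, zero_comp]⟩
      · exact ⟨Sigma.ι (fun _ : c i ⟶ x => c i) b,
          (Sigma.ι_desc (fun f : c i ⟶ x => f) b).symm⟩
    · obtain ⟨s, rfl⟩ := dist_yoneda₃ hC t (hxy k (by push_cast; lia) y hy _)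
      obtain ⟨y', hy', ⟨i⟩⟩ := hc.exists_inHeart_shift hy
      -- Here `y'` has index `k - 1 > n`, so it receives nothing from copies of `c n`.
      have hs : HomVanishes (P⟦(1 : ℤ)⟧) y :=
        ((homVanishes_shift_iff P y' 1).2
          (HomVanishes.sigma fun _ => hy' n (by lia))).of_iso (Iso.refl _) i
      rw [hs s, comp_zero]

end IsSiltingFamily

theorem homVanishes_of_iteratedStar {c : ℤ → T} (d : ℕ) : ∀ (n : ℤ) (x : T),
    iteratedStar (fun j : ℕ => addClosure (c (n + j))) d x →
    ∀ k, n + d < k → ∀ y, InHeart c k y → HomVanishes x y := by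
  induction d with
  | zero =>
    intro n x hx k hk y hy
    exact addClosure.homVanishes hx (hy _ (by lia))
  | succ d ih =>
    rintro n x ⟨P, C, p, g, δ, hC, hP, hC'⟩ k hk y hy f
    obtain ⟨t, rfl⟩ := dist_yoneda₂ hC f (addClosure.homVanishes hP (hy _ (by lia)) _)
    have hC'' : iteratedStar (fun j : ℕ => addClosure (c (n + 1 + j))) d C := by
      rwa [addClosure_add_one_add]
    rw [ih (n + 1) C hC'' k (by push_cast at hk; lia) y hy t, comp_zero]

/-! ### Passing from the shifts of `M` to a silting family. -/

section Shifts

lemma exists_iso_shift_add (a : T) (m n l : ℤ) (h : m + n = l) :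
    Nonempty (a⟦m⟧⟦n⟧ ≅ a⟦l⟧) :=
  ⟨((shiftFunctorAdd' T m n l h).app a).symm⟩

lemma homVanishes_shift_shift_iff (a y : T) (i j k : ℤ) (h : i + k = j) (l : ℤ) :
    HomVanishes (a⟦j⟧) (y⟦l + k⟧) ↔ HomVanishes (a⟦i⟧) (y⟦l⟧) := by
  obtain ⟨e⟩ := exists_iso_shift_add a i k j h
  obtain ⟨e'⟩ := exists_iso_shift_add y l k _ rfl
  rw [← homVanishes_shift_iff (a⟦i⟧) (y⟦l⟧) k]
  exact ⟨fun h => h.of_iso e.symm e'.symm, fun h => h.of_iso e e'⟩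

lemma homVanishes_shift_zero_right_iff (a y : T) :
    HomVanishes a (y⟦(0 : ℤ)⟧) ↔ HomVanishes a y :=
  ⟨fun h => h.of_iso (Iso.refl _) ((shiftFunctorZero T ℤ).app y),
    fun h => h.of_iso (Iso.refl _) ((shiftFunctorZero T ℤ).app y).symm⟩

lemma homVanishes_shift_zero_left_iff (a y : T) :
    HomVanishes (a⟦(0 : ℤ)⟧) y ↔ HomVanishes a y :=
  ⟨fun h => h.of_iso ((shiftFunctorZero T ℤ).app a) (Iso.refl _),
    fun h => h.of_iso ((shiftFunctorZero T ℤ).app a).symm (Iso.refl _)⟩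

lemma homVanishes_shift_left_iff (a y : T) (i : ℤ) :
    HomVanishes (a⟦i⟧) y ↔ HomVanishes a (y⟦-i⟧) := by
  rw [← homVanishes_shift_zero_right_iff, ← homVanishes_shift_zero_left_iff a,
    ← homVanishes_shift_shift_iff a y 0 i i (by lia) (-i), neg_add_cancel]

lemma homVanishes_shift_iff_sub (a y : T) (i k : ℤ) :
    HomVanishes (a⟦i⟧) (y⟦k⟧) ↔ HomVanishes (a⟦i - k⟧) y := by
  rw [← homVanishes_shift_zero_right_iff (a⟦i - k⟧) y,
    ← homVanishes_shift_shift_iff a y (i - k) i k (by lia) 0, zero_add]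

lemma perp_iff (M : T) (I : Set ℤ) (y : T) :
    perp M I y ↔ ∀ i ∈ I, HomVanishes (M⟦-i⟧) y := by
  simp only [homVanishes_shift_left_iff, neg_neg]
  rfl

lemma heart_iff (M y : T) : heart M y ↔ InHeart (fun i => M⟦i⟧) 0 y := by
  refine (perp_iff _ _ _).trans ⟨fun h i hi => ?_, fun h i hi => h _ (neg_ne_zero.2 hi)⟩
  simpa using h (-i) (neg_ne_zero.2 hi)

lemma homVanishesAbove_heart_iff (M x : T) (n : ℤ) :
    HomVanishesAbove (heart M) x n ↔
      ∀ k, n < k → ∀ y, InHeart (fun i => M⟦i⟧) k y → HomVanishes x y := by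
  constructor
  · intro h k hk y hy
    obtain ⟨e⟩ := exists_iso_shift_add y (-k) k 0 (neg_add_cancel k)
    have h1 : HomVanishes x (y⟦-k⟧⟦k⟧) := by
      refine h (y⟦-k⟧) ((heart_iff _ _).2 fun i hi => ?_) k hk
      rw [homVanishes_shift_iff_sub]
      exact hy _ (by lia)
    exact (homVanishes_shift_zero_right_iff _ _).1 (h1.of_iso (Iso.refl _) e)
  · intro h y hy k hk
    refine h k hk _ fun i hi => ?_
    rw [homVanishes_shift_iff_sub]
    exact (heart_iff _ _).1 hy _ (by lia)

lemma pd_le_iff (H : ObjectProperty T) (x : T) (n : ℤ) :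
    pd H x ≤ ((n : WithTop ℤ) : WithBot (WithTop ℤ)) ↔ HomVanishesAbove H x n := by
  constructor
  · intro h
    by_contra hn
    -- Vanishing above `m` persists above any larger integer, so if `n` fails, every admissible
    -- bound is at least `n + 1`.
    have : (((n + 1 : ℤ) : WithTop ℤ) : WithBot (WithTop ℤ)) ≤ pd H x := by
      refine le_sInf ?_
      rintro _ ⟨m, rfl, hm⟩
      rw [WithBot.coe_le_coe, WithTop.coe_le_coe]
      by_contra hmn
      exact hn fun y hy k hk => hm y hy k (by lia)
    have := this.trans h
    rw [WithBot.coe_le_coe, WithTop.coe_le_coe] at this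
    lia
  · exact fun h => sInf_le ⟨n, rfl, h⟩

/-- The left orthogonal of all shifts of `y` is thick, so it contains the thick closure of `M` as
soon as it contains `M`. This lets `M` alone detect zero objects. -/
lemma eq_zero_of_triangEnvelope [IsTriangulated T] (M y : T)
    (h : ∀ n : ℤ, HomVanishes (M⟦n⟧) y) (a : T)
    (ha : (ObjectProperty.singleton M).triangEnvelope a) (n : ℤ) : HomVanishes a (y⟦n⟧) := by
  let Q : ObjectProperty T :=
    ((ObjectProperty.singleton y).shiftClosure ℤ).leftOrthogonal
  have : Q.IsStableUnderRetracts := ⟨fun r hY _ f hf => HomVanishes.of_retract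
    (fun g => hY g hf) r f⟩
  have hQ : (ObjectProperty.singleton M).triangEnvelope ≤ Q := by
    rw [ObjectProperty.triangEnvelope_le_iff]
    rintro _ ⟨⟩ Z f ⟨_, m, e, ⟨⟩⟩
    have := (homVanishes_shift_left_iff M y (-m)).1 (h _)
    rw [neg_neg] at this
    exact this.of_iso (Iso.refl _) e.symm f
  exact fun f => hQ a ha f ⟨y, n, Iso.refl _, ⟨()⟩⟩

lemma IsCompactSilting.isSiltingFamily [IsTriangulated T] (hT : IsCompactlyGenerated T) {M : T}
    (hM : IsCompactSilting M) : IsSiltingFamily fun i : ℤ => M⟦i⟧ where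
  compact_obj n := by
    rw [← hM.thick_eq_compact]
    exact (ObjectProperty.singleton M).triangEnvelope.le_shift n _
      (ObjectProperty.le_triangEnvelope _ _ ⟨()⟩)
  homVanishes_of_lt i j hij := by
    have : HomVanishes M (M⟦j - i⟧) := hM.hom_shift_eq_zero (j - i) (by lia)
    rwa [← homVanishes_shift_zero_left_iff, ← homVanishes_shift_shift_iff M M 0 i i (by lia),
      sub_add_cancel] at this
  isZero y hy := by
    obtain ⟨ι, G, hG, hG'⟩ := hT
    exact hG' y fun i n => eq_zero_of_triangEnvelope M y hy (G i)
      (by rw [hM.thick_eq_compact]; exact hG i) n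
  shiftIso n := exists_iso_shift_add M n 1 (n + 1) rfl

end Shifts

end SiltingPd

theorem proposition2p15 {T : Type u} [Category.{v} T] [Preadditive T] [HasZeroObject T]
    [HasShift T ℤ] [∀ n : ℤ, (shiftFunctor T n).Additive] [Pretriangulated T]
    [IsTriangulated T] [HasCoproducts.{v} T]
    (hT : SiltingPd.IsCompactlyGenerated T)
    (M : T) (hM : SiltingPd.IsCompactSilting M)
    (x : T) (hx : SiltingPd.bounded T x) (hx' : SiltingPd.perp M {i | 0 < i} x) (d : ℕ) :
    SiltingPd.iteratedStar (fun i : ℕ => SiltingPd.addClosure (M⟦(i : ℤ)⟧)) d x ↔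
      SiltingPd.pd (SiltingPd.heart M) x ≤ (((d : ℤ) : WithTop ℤ) : WithBot (WithTop ℤ)) := by
  have hc := hM.isSiltingFamily hT
  have hstar : SiltingPd.iteratedStar
      (fun i : ℕ => SiltingPd.addClosure (M⟦(i : ℤ)⟧)) d x ↔
      SiltingPd.iteratedStar (fun i : ℕ => SiltingPd.addClosure (M⟦(0 : ℤ) + i⟧)) d x := by
    simp only [zero_add]
  rw [SiltingPd.pd_le_iff, SiltingPd.homVanishesAbove_heart_iff, hstar]
  constructor
  · intro h k hk
    exact SiltingPd.homVanishes_of_iteratedStar (c := fun i : ℤ => M⟦i⟧) d 0 x h k (by simpa using hk)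
  · intro h
    refine hc.iteratedStar_of_homVanishes d 0 x (fun i hi => ?_) fun k hk => h k (by simpa using hk)
    simpa using (SiltingPd.perp_iff _ _ _).1 hx' (-i) (by simpa using hi)
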